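/- Let $H(\mathbb D)$ be the space of analytic functions on the open unit disc $\mathbb D$. A \emph{weight} is a continuous strictly positive function $v$ on $\mathbb D$ with $\lim_{|z|\to1}v(z)=0$; it is \emph{normal} if $v(z)=v(|z|)$ for all $z$, $v$ is non-increasing in $|z|$, $$\inf_{k\in\mathbb N}\limsup_{n\to\infty}\frac{v(1-2^{-n-k})}{v(1-2^{-n})}<1\quad\text{and}\quad \sup_{n\in\mathbb N}\frac{v(1-2^{-n})}{v(1-2^{-n-1})}<\infty .$$ Put $\|f\|_{H_v^\infty}=\sup_{z\in\mathbb D}v(z)|f(z)|$ and $\|f\|_{\mathcal B_v^\infty}=|f(0)|+\sup_{z\in\mathbb D}v(z)|f'(z)|$, and let $H_v^\infty$, $\mathcal B_v^\infty$ be the spaces of those $f\in H(\mathbb D)$ for which the respective norm is finite. For $g\in H(\mathbb D)$ and an analytic map $\varphi:\mathbb D\to\mathbb D$ let $$T_g^\varphi f(z)=\int_0^{\varphi(z)}f(\xi)g'(\xi)\,d\xi ,\qquad f\in H(\mathbb D),\ z\in\mathbb D.$$ The essential norm $\|T\|_e$ of a bounded operator is its distance, in operator norm, to the compact operators between the same spaces.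 Let $\mathcal X\subset H(\mathbb D)$ be a Banach space containing the constant functions, let $\|\delta_z\|$ be the norm of the evaluation functional $f\mapsto f(z)$ on $\mathcal X$, and assume: (I) the closed unit ball of $\mathcal X$ is compact in the topology of uniform convergence on compact subsets of $\mathbb D$; (II) $\lim_{|z|\to1}\|\delta_z\|=\infty$; (III) for every $0<r<1$ the operator $T_r f(z)=f(rz)$ maps $\mathcal X$ to $\mathcal X$ and is compact; (IV) $\sup_{0<r<1}\|T_r\|_{\mathcal X\to\mathcal X}<\infty$; (V) there is a constant $C$ such that every bounded $u\in H(\mathbb D)$ induces a multiplication operator $M_uf=uf$ on $\mathcal X$ with $\|M_u\|_{\mathcal X\to\mathcal X}\le C\sup_{z\in\mathbb D}|u(z)|$. Below, $\limsup_{|\varphi(z)|\to1}F(z)$ means $\lim_{s\to1^-}\sup\{F(z):|\varphi(z)|>s\}$, with $\sup\emptyset=0$. (i) For every normal weight $v$ there is a constant $c>0$, depending only on $\mathcal X$ and $v$, such that for all $g\in H(\mathbb D)$ and all analytic $\varphi:\mathbb D\to\mathbb D$ for which $T_g^\varphi:\mathcal X\to H_v^\infty$ is bounded, $$c^{-1}L\le\|T_g^\varphi\|_{e,\mathcal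 X\to H_v^\infty}\le cL,\qquad L=\limsup_{|\varphi(z)|\to1}(1-|z|)\,v(z)\,|(g\circ\varphi)'(z)|\,\|\delta_{\varphi(z)}\| .$$ (ii) There is a constant $c>0$, depending only on $\mathcal X$, such that for all weights $v$, all $g\in H(\mathbb D)$ and all analytic $\varphi:\mathbb D\to\mathbb D$ for which $T_g^\varphi:\mathcal X\to\mathcal B_v^\infty$ is bounded, $$c^{-1}L\le\|T_g^\varphi\|_{e,\mathcal X\to\mathcal B_v^\infty}\le cL,\qquad L=\limsup_{|\varphi(z)|\to1}v(z)\,|(g\circ\varphi)'(z)|\,\|\delta_{\varphi(z)}\| .$$ -/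

import Mathlib

open Complex Filter Topology
open scoped ENNReal NNReal Complex.UnitDisc

noncomputable section

namespace VolterraEss

/-- Extension of a function on the unit disc to `ℂ` by zero. It only serves to speak about complex
derivatives at points of the (open) disc and about values at complex numbers of modulus `< 1`. -/
def ext (f : 𝔻 → ℂ) (z : ℂ) : ℂ :=
  if h : ‖z‖ < 1 then f (UnitDisc.mk z h) else 0

theorem ext_coe (f : 𝔻 → ℂ) (z : 𝔻) : ext f z = f z := by
  simp [ext, z.norm_lt_one]

theorem ext_add (f g : 𝔻 → ℂ) : ext (f + g) = ext f + ext g := by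
  funext z
  by_cases h : ‖z‖ < 1 <;> simp [ext, h]

theorem ext_smul (c : ℂ) (f : 𝔻 → ℂ) : ext (c • f) = c • ext f := by
  funext z
  by_cases h : ‖z‖ < 1 <;> simp [ext, h]

theorem ext_zero : ext 0 = 0 := by
  funext z
  simp [ext]

/-- `f` is analytic (holomorphic) on the unit disc. -/
def IsHol (f : 𝔻 → ℂ) : Prop := DifferentiableOn ℂ (ext f) (Metric.ball 0 1)

/-- The complex derivative `f'(z)` of a function on the disc. -/
def dd (f : 𝔻 → ℂ) (z : 𝔻) : ℂ := deriv (ext f) z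

/-- The analytic functions as a subspace of `C(𝔻, ℂ)`. -/
def holSub : Submodule ℂ C(𝔻, ℂ) where
  carrier := {f | IsHol f}
  add_mem' {f g} hf hg := by
    change IsHol (f + g)
    unfold IsHol at *
    rw [ext_add]
    exact DifferentiableOn.add hf hg
  zero_mem' := by
    change DifferentiableOn ℂ (ext 0) _
    rw [ext_zero]
    exact differentiableOn_const 0
  smul_mem' c f hf := by
    change IsHol (c • ⇑f)
    unfold IsHol at *
    rw [ext_smul]
    exact DifferentiableOn.const_smul hf c

/-- The space `H(𝔻)` of analytic functions on the unit disc, with the compact-open topology. -/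
def HolD : Type := ↥holSub

instance : AddCommGroup HolD := inferInstanceAs (AddCommGroup ↥holSub)

instance : Module ℂ HolD := inferInstanceAs (Module ℂ ↥holSub)

instance : TopologicalSpace HolD := inferInstanceAs (TopologicalSpace ↥holSub)

instance : CoeFun HolD fun _ => 𝔻 → ℂ := ⟨fun f => f.1⟩

theorem HolD.isHol (f : HolD) : IsHol f := f.2

theorem HolD.add_apply (f g : HolD) (z : 𝔻) : (f + g) z = f z + g z := rfl

theorem HolD.smul_apply (c : ℂ) (f : HolD) (z : 𝔻) : (c • f) z = c * f z := rfl

theorem HolD.differentiableAt (f : HolD) (z : 𝔻) : DifferentiableAt ℂ (ext f) z :=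
  f.isHol.differentiableAt (Metric.isOpen_ball.mem_nhds (mem_ball_zero_iff.2 z.norm_lt_one))

theorem HolD.dd_add (f g : HolD) (z : 𝔻) : dd (f + g : HolD) z = dd f z + dd g z := by
  change deriv (ext (⇑f.1 + ⇑g.1)) z = _
  rw [ext_add]
  exact deriv_add (f.differentiableAt z) (g.differentiableAt z)

theorem HolD.dd_smul (c : ℂ) (f : HolD) (z : 𝔻) : dd (c • f : HolD) z = c * dd f z := by
  change deriv (ext (c • ⇑f.1)) z = _
  rw [ext_smul]
  exact deriv_const_smul c (f.differentiableAt z)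

theorem HolD.eq_zero_of_dd (f : HolD) (h0 : f 0 = 0) (h : ∀ z, dd f z = 0) : f = 0 := by
  apply Subtype.ext
  ext z
  have h1 : Set.EqOn (deriv (ext f)) 0 (Metric.ball 0 1) := fun w hw =>
    h (UnitDisc.mk w (mem_ball_zero_iff.1 hw))
  have h2 := Metric.isOpen_ball.is_const_of_deriv_eq_zero
    (convex_ball (0 : ℂ) 1).isPreconnected f.isHol h1
    (mem_ball_zero_iff.2 z.norm_lt_one) (mem_ball_zero_iff.2 (0 : 𝔻).norm_lt_one)
  rw [ext_coe, ext_coe] at h2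
  exact h2.trans h0

/-- The filter of all `z` in the disc with `|z| → 1`. -/
def toBoundary : Filter 𝔻 := comap (fun z => ‖(z : ℂ)‖) (𝓝 1)

/-- A weight: a continuous strictly positive function on the disc tending to `0` as `|z| → 1`. -/
structure Weight where
  toFun : 𝔻 → ℝ
  continuous_toFun : Continuous toFun
  pos : ∀ z, 0 < toFun z
  tendsto_zero : Tendsto toFun toBoundary (𝓝 0)

instance : CoeFun Weight fun _ => 𝔻 → ℝ := ⟨Weight.toFun⟩

/-- The point `1 - 2⁻ⁿ` of the disc. -/
def dyadic (n : ℕ) : 𝔻 :=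
  UnitDisc.mk ((1 - (1 / 2) ^ n : ℝ) : ℂ) (by
    have h1 : (0 : ℝ) < (1 / 2) ^ n := by positivity
    have h2 : ((1 : ℝ) / 2) ^ n ≤ 1 := pow_le_one₀ (by norm_num) (by norm_num)
    rw [Complex.norm_real, Real.norm_eq_abs, abs_lt]
    constructor <;> linarith)

/-- Normal weights. The two quotients are read in `[0, ∞]`. -/
structure Weight.IsNormal (v : Weight) : Prop where
  radial : ∀ z w : 𝔻, ‖(z : ℂ)‖ = ‖(w : ℂ)‖ → v z = v w
  antitone : ∀ z w : 𝔻, ‖(z : ℂ)‖ ≤ ‖(w : ℂ)‖ → v w ≤ v z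
  inf_limsup_lt_one :
    ⨅ k : ℕ, limsup (fun n : ℕ => ENNReal.ofReal (v (dyadic (n + k)) / v (dyadic n))) atTop < 1
  sup_lt_top : ⨆ n : ℕ, ENNReal.ofReal (v (dyadic n) / v (dyadic (n + 1))) < ∞

section Bounds

variable (v : Weight) (u : HolD → 𝔻 → ℂ)

/-- For `u f z` linear in `f`: those `f` for which `v(z) |u f z|` is bounded form a subspace. -/
def bddSub (hadd : ∀ f g z, u (f + g) z = u f z + u g z)
    (hsmul : ∀ (c : ℂ) f z, u (c • f) z = c * u f z) : Submodule ℂ HolD where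
  carrier := {f | BddAbove (Set.range fun z => v z * ‖u f z‖)}
  add_mem' {f g} := by
    rintro ⟨A, hA⟩ ⟨B, hB⟩
    refine ⟨A + B, ?_⟩
    rintro _ ⟨z, rfl⟩
    have h1 : v z * ‖u f z‖ ≤ A := hA ⟨z, rfl⟩
    have h2 : v z * ‖u g z‖ ≤ B := hB ⟨z, rfl⟩
    have h3 := mul_le_mul_of_nonneg_left (norm_add_le (u f z) (u g z)) (v.pos z).le
    simp only [hadd]
    linarith
  zero_mem' := by
    refine ⟨0, ?_⟩
    rintro _ ⟨z, rfl⟩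
    have h := hsmul 0 0 z
    rw [zero_smul, zero_mul] at h
    simp [h]
  smul_mem' c f := by
    rintro ⟨A, hA⟩
    refine ⟨‖c‖ * A, ?_⟩
    rintro _ ⟨z, rfl⟩
    have h1 : v z * ‖u f z‖ ≤ A := hA ⟨z, rfl⟩
    have h2 := mul_le_mul_of_nonneg_left h1 (norm_nonneg c)
    simp only [hsmul, norm_mul]
    linarith

variable {v u}

theorem iSup_smul (hsmul : ∀ (c : ℂ) f z, u (c • f) z = c * u f z) (c : ℂ) (f : HolD) :
    ⨆ z, v z * ‖u (c • f) z‖ = ‖c‖ * ⨆ z, v z * ‖u f z‖ := by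
  rw [Real.mul_iSup_of_nonneg (norm_nonneg c)]
  congr 1
  funext z
  rw [hsmul, norm_mul]
  ring

theorem iSup_add_le (hadd : ∀ f g z, u (f + g) z = u f z + u g z) {f g : HolD}
    (hf : BddAbove (Set.range fun z => v z * ‖u f z‖))
    (hg : BddAbove (Set.range fun z => v z * ‖u g z‖)) :
    ⨆ z, v z * ‖u (f + g) z‖ ≤ (⨆ z, v z * ‖u f z‖) + ⨆ z, v z * ‖u g z‖ := by
  have : Nonempty 𝔻 := ⟨0⟩
  refine ciSup_le fun z => ?_
  have h1 : v z * ‖u f z‖ ≤ _ := le_ciSup hf z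
  have h2 : v z * ‖u g z‖ ≤ _ := le_ciSup hg z
  have h3 := mul_le_mul_of_nonneg_left (norm_add_le (u f z) (u g z)) (v.pos z).le
  rw [hadd]
  linarith

theorem iSup_nonneg' (f : HolD) : 0 ≤ ⨆ z, v z * ‖u f z‖ :=
  Real.iSup_nonneg fun z => mul_nonneg (v.pos z).le (norm_nonneg _)

theorem eq_zero_of_iSup {f : HolD} (hf : BddAbove (Set.range fun z => v z * ‖u f z‖))
    (h : ⨆ z, v z * ‖u f z‖ ≤ 0) (z : 𝔻) : u f z = 0 := by
  have h1 : v z * ‖u f z‖ ≤ 0 := (le_ciSup hf z).trans h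
  have h2 : ‖u f z‖ ≤ 0 := by
    by_contra hc
    exact absurd h1 (not_le.2 (mul_pos (v.pos z) (not_le.1 hc)))
  exact norm_le_zero_iff.1 h2

end Bounds

/-! ### The space `H_v^∞` -/

/-- The subspace of all `f ∈ H(𝔻)` with `sup_z v(z) |f(z)| < ∞`. -/
def hInfSub (v : Weight) : Submodule ℂ HolD :=
  bddSub v (fun f z => f z) HolD.add_apply HolD.smul_apply

/-- The weighted space `H_v^∞` (a separate type, as its topology is the norm topology and not the
compact-open one). -/
def HInf (v : Weight) : Type := ↥(hInfSub v)

namespace HInf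

variable {v : Weight}

instance : AddCommGroup (HInf v) := inferInstanceAs (AddCommGroup ↥(hInfSub v))

instance : Module ℂ (HInf v) := inferInstanceAs (Module ℂ ↥(hInfSub v))

/-- An element of `H_v^∞` as an analytic function on the disc. -/
def toHolD (f : HInf v) : HolD := Subtype.val f

instance : Norm (HInf v) := ⟨fun f => ⨆ z, v z * ‖f.toHolD z‖⟩

theorem norm_def (f : HInf v) : ‖f‖ = ⨆ z, v z * ‖f.toHolD z‖ := rfl

theorem bdd (f : HInf v) : BddAbove (Set.range fun z => v z * ‖f.toHolD z‖) := f.2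

theorem core (v : Weight) : NormedSpace.Core ℂ (HInf v) where
  norm_nonneg f := iSup_nonneg' (u := fun f z => f z) f.toHolD
  norm_smul c f := iSup_smul (u := fun f z => f z) HolD.smul_apply c f.toHolD
  norm_triangle f g := iSup_add_le (u := fun f z => f z) HolD.add_apply f.bdd g.bdd
  norm_eq_zero_iff f := by
    constructor
    · intro h
      have h1 := eq_zero_of_iSup (u := fun f z => f z) f.bdd h.le
      apply Subtype.ext
      apply Subtype.ext
      ext z
      exact h1 z
    · rintro rfl
      have h := iSup_smul (v := v) (u := fun f z => f z) HolD.smul_apply 0 0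
      rw [zero_smul, norm_zero, zero_mul] at h
      exact h

instance : NormedAddCommGroup (HInf v) := NormedAddCommGroup.ofCore (core v)

instance : NormedSpace ℂ (HInf v) := NormedSpace.ofCore (core v)

end HInf

/-! ### The Bloch-type space `B_v^∞` -/

/-- The subspace of all `f ∈ H(𝔻)` with `sup_z v(z) |f'(z)| < ∞`. -/
def blochSub (v : Weight) : Submodule ℂ HolD :=
  bddSub v (fun f z => dd f z) HolD.dd_add HolD.dd_smul

/-- The Bloch-type space `B_v^∞`. -/
def Bloch (v : Weight) : Type := ↥(blochSub v)

namespace Bloch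

variable {v : Weight}

instance : AddCommGroup (Bloch v) := inferInstanceAs (AddCommGroup ↥(blochSub v))

instance : Module ℂ (Bloch v) := inferInstanceAs (Module ℂ ↥(blochSub v))

/-- An element of `B_v^∞` as an analytic function on the disc. -/
def toHolD (f : Bloch v) : HolD := Subtype.val f

instance : Norm (Bloch v) := ⟨fun f => ‖f.toHolD 0‖ + ⨆ z, v z * ‖dd f.toHolD z‖⟩

theorem norm_def (f : Bloch v) : ‖f‖ = ‖f.toHolD 0‖ + ⨆ z, v z * ‖dd f.toHolD z‖ := rfl

theorem bdd (f : Bloch v) : BddAbove (Set.range fun z => v z * ‖dd f.toHolD z‖) := f.2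

theorem core (v : Weight) : NormedSpace.Core ℂ (Bloch v) where
  norm_nonneg f :=
    add_nonneg (norm_nonneg _) (iSup_nonneg' (u := fun f z => dd f z) f.toHolD)
  norm_smul c f := by
    have h1 := iSup_smul (v := v) (u := fun f z => dd f z) HolD.dd_smul c f.toHolD
    have h2 : ‖(c • f.toHolD) 0‖ = ‖c‖ * ‖f.toHolD 0‖ := by
      rw [HolD.smul_apply, norm_mul]
    rw [norm_def, norm_def, mul_add, ← h1, ← h2]
    rfl
  norm_triangle f g := by
    have h1 := iSup_add_le (u := fun f z => dd f z) HolD.dd_add f.bdd g.bdd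
    have h2 : ‖(f.toHolD + g.toHolD) 0‖ ≤ ‖f.toHolD 0‖ + ‖g.toHolD 0‖ := norm_add_le _ _
    rw [norm_def, norm_def, norm_def]
    refine (add_le_add h2 h1).trans (le_of_eq ?_)
    ring
  norm_eq_zero_iff f := by
    constructor
    · intro h
      have h0 := norm_nonneg (f.toHolD 0)
      have h1 := iSup_nonneg' (v := v) (u := fun f z => dd f z) f.toHolD
      rw [norm_def] at h
      apply Subtype.ext
      exact HolD.eq_zero_of_dd f.toHolD (norm_le_zero_iff.1 (by linarith))
        (eq_zero_of_iSup (u := fun f z => dd f z) f.bdd (by linarith))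
    · rintro rfl
      have h := iSup_smul (v := v) (u := fun f z => dd f z) HolD.dd_smul 0 0
      rw [zero_smul, norm_zero, zero_mul] at h
      have h2 : ‖((0 : Bloch v).toHolD) 0‖ = 0 := norm_zero
      rw [norm_def, h2, zero_add]
      exact h

instance : NormedAddCommGroup (Bloch v) := NormedAddCommGroup.ofCore (core v)

instance : NormedSpace ℂ (Bloch v) := NormedSpace.ofCore (core v)

end Bloch

/-! ### Banach spaces of analytic functions

A Banach space `X ⊆ H(𝔻)` is given by a Banach space `X` and the (injective, linear) inclusion
`ι : X → H(𝔻)`. -/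

section Conditions

variable {X : Type*} [NormedAddCommGroup X] [NormedSpace ℂ X] (ι : X →ₗ[ℂ] HolD)

/-- The norm `‖δ_z‖ = sup {|f(z)| : ‖f‖ ≤ 1}` of the evaluation functional, in `[0, ∞]`. -/
def evalNorm (z : 𝔻) : ℝ≥0∞ := ⨆ (f : X) (_ : ‖f‖ ≤ 1), ‖ι f z‖ₑ

/-- `X` contains the constant functions. -/
def ContainsConstants : Prop := ∀ c : ℂ, ∃ f : X, ∀ z, ι f z = c

/-- (I): the closed unit ball is compact in the compact-open topology. -/
def CondI : Prop := IsCompact (ι '' Metric.closedBall (0 : X) 1)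

/-- (II): `‖δ_z‖ → ∞` as `|z| → 1`. -/
def CondII : Prop := Tendsto (evalNorm ι) toBoundary (𝓝 ∞)

/-- `S` is the operator `T_r : X → X`, `f ↦ f_r`, `f_r(z) = f(rz)`. -/
def IsDilation (r : ℝ) (S : X →L[ℂ] X) : Prop :=
  ∀ f z, ι (S f) z = ext (ι f) (r * z)

/-- (III): for `0 < r < 1` the operator `T_r : X → X` is (well defined and) compact. -/
def CondIII : Prop :=
  ∀ r : ℝ, 0 < r → r < 1 → ∃ S : X →L[ℂ] X, IsDilation ι r S ∧ IsCompactOperator S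

/-- (IV): `sup_{0 < r < 1} ‖T_r‖ < ∞`. -/
def CondIV : Prop :=
  ∃ C : ℝ, ∀ r : ℝ, 0 < r → r < 1 → ∃ S : X →L[ℂ] X, IsDilation ι r S ∧ ‖S‖ ≤ C

/-- (V): for `u ∈ H^∞`, multiplication by `u` is a bounded operator on `X`, of norm at most a
constant times `‖u‖_∞`. -/
def CondV : Prop :=
  ∃ C : ℝ, ∀ u : HolD, BddAbove (Set.range fun z => ‖u z‖) →
    ∃ M : X →L[ℂ] X, (∀ f z, ι (M f) z = u z * ι f z) ∧ ‖M‖ ≤ C * ⨆ z, ‖u z‖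

end Conditions

/-- The essential norm of a bounded operator: its distance to the compact operators. -/
def essNorm {X Y : Type*} [NormedAddCommGroup X] [NormedSpace ℂ X] [NormedAddCommGroup Y]
    [NormedSpace ℂ Y] (T : X →L[ℂ] Y) : ℝ≥0∞ :=
  ⨅ (K : X →L[ℂ] Y) (_ : IsCompactOperator K), ‖T - K‖ₑ

/-- The generalized Volterra operator `T_g^φ f (z) = ∫_0^{φ(z)} f(ξ) g'(ξ) dξ`, the integral taken
along the segment `ξ = t φ(z)`, `0 ≤ t ≤ 1`. -/
def volterra (g : HolD) (φ : 𝔻 → 𝔻) (f : HolD) (z : 𝔻) : ℂ :=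
  ∫ t in (0 : ℝ)..1, ext f (t * φ z) * deriv (ext g) (t * φ z) * φ z

/-- `limsup_{|φ(z)| → 1} F(z) = lim_{s → 1} sup_{|φ(z)| > s} F(z)`, which is `0` if `|φ|` is bounded
away from `1`. -/
def limsupAt (φ : 𝔻 → 𝔻) (F : 𝔻 → ℝ≥0∞) : ℝ≥0∞ :=
  limsup F (comap φ toBoundary)

end VolterraEss

end

noncomputable section

namespace VolterraEss

/-! Everything rests on `(T f)'(z) = f(φ(z)) (g ∘ φ)'(z)` (`dd_volterra`), which removes the
integral from the Bloch-type norm.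

Upper bound (`essNorm_le_limsupAt`): each `T ∘ T_r` is compact, so it suffices to bound `T (f - T_r
f)` on the unit ball for one `r` close to 1. Where `|φ(z)| ≤ s`, the factor `f - T_r f` is uniformly
small by Cauchy estimates, and `v |(g ∘ φ)'| ≤ ‖T 1‖`. Where `|φ(z)| > s`, the factor is at most `(1
+ C) ‖δ_{φ(z)}‖`, which produces the limsup.

Lower bound (`limsupAt_le_of_isCompactOperator`): given a compact `K`, dilates of functions nearly
extremal for `δ_{φ(z)}` are bounded functions in a fixed ball of `X`. Their images under `K` are
approximated by finitely many `K h` with `h` bounded, so `|h| ≤ M` for one `M`. Since `‖δ_{φ(z)}‖ →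
∞`, subtracting `h` costs little at `φ(z)`, while `K` nearly annihilates the difference. Hence `T -
K` must be large there.

The `H_v^∞` statement is reduced to the Bloch one: for normal `v`, the space `H_v^∞` coincides, with
equivalent norms, with the Bloch-type space of weight `(1 - |z|) v(z)`. One inclusion is Cauchy's
estimate (`exists_norm_dd_le`), the other radial integration (`exists_norm_apply_le`). -/

/-! ### Evaluation, compact subdiscs and Cauchy estimates -/

theorem ext_of_norm_lt (f : 𝔻 → ℂ) {z : ℂ} (h : ‖z‖ < 1) : ext f z = f (UnitDisc.mk z h) := by
  simp [ext, h]

theorem HolD.zero_apply (z : 𝔻) : (0 : HolD) z = 0 := rfl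

theorem HolD.sub_apply (f g : HolD) (z : 𝔻) : (f - g) z = f z - g z := rfl

theorem HolD.continuous_eval : Continuous fun p : HolD × 𝔻 => p.1 p.2 := by
  have : LocallyCompactSpace 𝔻 :=
    (Metric.isOpen_ball : IsOpen (Metric.ball (0 : ℂ) 1)).locallyCompactSpace
  have h : Continuous fun p : C(𝔻, ℂ) × 𝔻 => p.1 p.2 := ContinuousEval.continuous_eval
  have h2 : Continuous fun p : HolD × 𝔻 => ((p.1.1 : C(𝔻, ℂ)), p.2) :=
    (continuous_subtype_val.comp continuous_fst).prodMk continuous_snd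
  exact h.comp h2

theorem isCompact_norm_le {s : ℝ} (hs : s < 1) : IsCompact {z : 𝔻 | ‖(z : ℂ)‖ ≤ s} := by
  have h := UnitDisc.isEmbedding_coe.isInducing.isCompact_preimage_iff
    (K := Metric.closedBall (0 : ℂ) s) (fun z hz =>
      ⟨UnitDisc.mk z ((mem_closedBall_zero_iff.1 hz).trans_lt hs), rfl⟩)
  convert h.2 (isCompact_closedBall _ _) using 1
  ext z
  simp

/-- Cauchy's estimate for the derivative at a point of the disc. -/
theorem HolD.norm_dd_le (f : HolD) {z : 𝔻} {ρ M : ℝ} (hρ : 0 < ρ) (hz : ‖(z : ℂ)‖ + ρ < 1)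
    (h : ∀ w : 𝔻, ‖(w : ℂ)‖ ≤ ‖(z : ℂ)‖ + ρ → ‖f w‖ ≤ M) : ‖dd f z‖ ≤ M / ρ := by
  have hb : ∀ w ∈ Metric.closedBall (z : ℂ) ρ, ‖w‖ ≤ ‖(z : ℂ)‖ + ρ := fun w hw => by
    have h1 := norm_add_le (z : ℂ) (w - z)
    rw [mem_closedBall_iff_norm] at hw
    rw [add_sub_cancel] at h1
    linarith
  refine norm_deriv_le_of_forall_mem_sphere_norm_le hρ ?_ fun w hw => ?_
  · refine DifferentiableOn.diffContOnCl ?_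
    rw [closure_ball _ hρ.ne']
    exact f.isHol.mono fun w hw => mem_ball_zero_iff.2 ((hb w hw).trans_lt hz)
  · have h1 := hb w (Metric.sphere_subset_closedBall hw)
    rw [ext_of_norm_lt _ (h1.trans_lt hz)]
    exact h _ h1

theorem HolD.norm_sub_le (f : HolD) {s M : ℝ} (hs : s < 1)
    (h : ∀ w : 𝔻, ‖(w : ℂ)‖ ≤ s → ‖dd f w‖ ≤ M) {z w : 𝔻} (hz : ‖(z : ℂ)‖ ≤ s)
    (hw : ‖(w : ℂ)‖ ≤ s) : ‖f z - f w‖ ≤ M * ‖(z : ℂ) - w‖ := by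
  have h1 := (convex_closedBall (0 : ℂ) s).norm_image_sub_le_of_norm_deriv_le
    (f := ext f) (C := M) (x := w) (y := z)
    (fun x hx => f.differentiableAt (UnitDisc.mk x ((mem_closedBall_zero_iff.1 hx).trans_lt hs)))
    (fun x hx => h (UnitDisc.mk x ((mem_closedBall_zero_iff.1 hx).trans_lt hs))
      (mem_closedBall_zero_iff.1 hx))
    (mem_closedBall_zero_iff.2 hw) (mem_closedBall_zero_iff.2 hz)
  rwa [ext_coe, ext_coe] at h1

theorem eventually_toBoundary {p : 𝔻 → Prop} (h : ∀ᶠ z in toBoundary, p z) :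
    ∃ s : ℝ, 0 < s ∧ s < 1 ∧ ∀ z : 𝔻, s < ‖(z : ℂ)‖ → p z := by
  rw [toBoundary, eventually_comap, Metric.eventually_nhds_iff] at h
  obtain ⟨ε, hε, h⟩ := h
  refine ⟨max (1 - ε) (1 / 2), by positivity, max_lt (by linarith) (by norm_num),
    fun z hz => h ?_ z rfl⟩
  have h1 := (le_max_left _ _).trans_lt hz
  have h2 := z.norm_lt_one
  rw [Real.dist_eq, abs_lt]
  constructor <;> linarith

/-! ### The derivative of the Volterra operator -/

theorem differentiableAt_ext_of_isHol {f : 𝔻 → ℂ} (hf : IsHol f) (z : 𝔻) :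
    DifferentiableAt ℂ (ext f) z :=
  hf.differentiableAt (Metric.isOpen_ball.mem_nhds (mem_ball_zero_iff.2 z.norm_lt_one))

/-- The chain rule for compositions `w ↦ G (φ w)` on the disc. -/
theorem dd_comp {G : ℂ → ℂ} {φ : 𝔻 → 𝔻} (hφ : IsHol fun z => (φ z : ℂ)) {z : 𝔻} {G' : ℂ}
    (hG : HasDerivAt G G' (φ z)) :
    dd (fun w => G (φ w)) z = G' * dd (fun w => (φ w : ℂ)) z := by
  have h1 : HasDerivAt (ext fun w => (φ w : ℂ)) (dd (fun w => (φ w : ℂ)) z) z :=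
    (differentiableAt_ext_of_isHol hφ z).hasDerivAt
  rw [← ext_coe (fun w => (φ w : ℂ)) z] at hG
  have h2 := hG.comp (z : ℂ) h1
  refine HasDerivAt.deriv (h2.congr_of_eventuallyEq ?_)
  filter_upwards [Metric.isOpen_ball.mem_nhds (mem_ball_zero_iff.2 z.norm_lt_one)] with w hw
  have hw' := mem_ball_zero_iff.1 hw
  simp [ext_of_norm_lt _ hw']

theorem dd_comp_holD (g : HolD) {φ : 𝔻 → 𝔻} (hφ : IsHol fun z => (φ z : ℂ)) (z : 𝔻) :
    dd (fun w => g (φ w)) z = dd g (φ z) * dd (fun w => (φ w : ℂ)) z := by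
  have h := dd_comp hφ (g.differentiableAt (φ z)).hasDerivAt
  simp only [ext_coe] at h
  exact h

theorem HolD.differentiableOn_deriv (g : HolD) :
    DifferentiableOn ℂ (deriv (ext g)) (Metric.ball 0 1) :=
  g.isHol.deriv Metric.isOpen_ball

theorem norm_ofReal_mul_lt {t : ℝ} (ht : t ∈ Set.Icc (0 : ℝ) 1) (w : 𝔻) : ‖(t : ℂ) * w‖ < 1 := by
  rw [norm_mul, Complex.norm_real, Real.norm_eq_abs, abs_of_nonneg ht.1]
  exact (mul_le_of_le_one_left (norm_nonneg _) ht.2).trans_lt w.norm_lt_one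

/-- The integrand `f g'` is holomorphic on a disc, hence has a primitive there. The primitive serves
every `φ` at once. -/
theorem exists_volterra_eq (g f : HolD) : ∃ P : ℂ → ℂ,
    (∀ w : 𝔻, HasDerivAt P (f w * dd g w) w) ∧
      ∀ (φ : 𝔻 → 𝔻) (z : 𝔻), volterra g φ f z = P (φ z) - P 0 := by
  have hd : DifferentiableOn ℂ (fun w => ext f w * deriv (ext g) w) (Metric.ball 0 1) :=
    f.isHol.mul g.differentiableOn_deriv
  obtain ⟨P, hP⟩ := hd.isExactOn_ball
  refine ⟨P, fun w => ?_, fun φ z => ?_⟩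
  · have h := hP w (mem_ball_zero_iff.2 w.norm_lt_one)
    dsimp only at h
    rwa [ext_coe] at h
  · have hmem : ∀ t ∈ Set.uIcc (0 : ℝ) 1, (t : ℂ) * φ z ∈ Metric.ball (0 : ℂ) 1 := fun t ht =>
      mem_ball_zero_iff.2 (norm_ofReal_mul_lt (by rwa [Set.uIcc_of_le zero_le_one] at ht) _)
    have h := intervalIntegral.integral_eq_sub_of_hasDerivAt (a := 0) (b := 1)
      (f := fun t : ℝ => P (t * φ z))
      (f' := fun t : ℝ => ext f (t * φ z) * deriv (ext g) (t * φ z) * φ z) (fun t ht => ?_) ?_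
    · simpa [volterra] using h
    · have h1 : HasDerivAt (fun t : ℝ => (t : ℂ) * φ z) (φ z) t := by
        simpa using (Complex.ofRealCLM.hasDerivAt (x := t)).mul_const (φ z : ℂ)
      exact (hP _ (hmem t ht)).comp t h1
    · refine ContinuousOn.intervalIntegrable ?_
      refine ContinuousOn.mul ?_ continuousOn_const
      exact hd.continuousOn.comp (by fun_prop) hmem

theorem dd_volterra {g f F : HolD} {φ : 𝔻 → 𝔻} (hφ : IsHol fun z => (φ z : ℂ))
    (hF : ∀ z, F z = volterra g φ f z) (z : 𝔻) :
    dd F z = f (φ z) * dd (fun w => g (φ w)) z := by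
  obtain ⟨P, hP, hv⟩ := exists_volterra_eq g f
  have h1 : (⇑F.1 : 𝔻 → ℂ) = fun w => P (φ w) - P 0 := by
    funext w
    rw [hF, hv]
  have h2 := dd_comp (G := fun w => P w - P 0) hφ ((hP (φ z)).sub_const (P 0))
  rw [h1, h2, dd_comp_holD g hφ]
  ring

/-- The value of the Volterra operator at `z` is controlled by the values of `f` on
`{|w| ≤ |φ(z)|}`. -/
theorem exists_norm_volterra_le (g : HolD) (φ : 𝔻 → 𝔻) (z : 𝔻) : ∃ B : ℝ, 0 ≤ B ∧
    ∀ (f : HolD) (M : ℝ), (∀ w : 𝔻, ‖(w : ℂ)‖ ≤ ‖(φ z : ℂ)‖ → ‖f w‖ ≤ M) →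
      ‖volterra g φ f z‖ ≤ M * B := by
  have hc : ContinuousOn (deriv (ext g)) (Metric.closedBall 0 ‖(φ z : ℂ)‖) :=
    g.differentiableOn_deriv.continuousOn.mono fun w hw =>
      mem_ball_zero_iff.2 ((mem_closedBall_zero_iff.1 hw).trans_lt (φ z).norm_lt_one)
  obtain ⟨B, hB⟩ := (isCompact_closedBall _ _).exists_bound_of_continuousOn hc
  have hB0 : 0 ≤ B := (norm_nonneg _).trans (hB 0 (mem_closedBall_zero_iff.2 (by simp)))
  refine ⟨B, hB0, fun f M hM => ?_⟩
  have hM0 : 0 ≤ M := (norm_nonneg _).trans (hM (φ z) le_rfl)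
  have h := intervalIntegral.norm_integral_le_of_norm_le_const (a := 0) (b := 1) (C := M * B)
    (f := fun t : ℝ => ext f (t * φ z) * deriv (ext g) (t * φ z) * φ z) (fun t ht => ?_)
  · simpa [volterra] using h
  · rw [Set.uIoc_of_le zero_le_one] at ht
    have ht' : t ∈ Set.Icc (0 : ℝ) 1 := ⟨ht.1.le, ht.2⟩
    have h1 : ‖(t : ℂ) * φ z‖ ≤ ‖(φ z : ℂ)‖ := by
      rw [norm_mul, Complex.norm_real, Real.norm_eq_abs, abs_of_nonneg ht'.1]
      exact mul_le_of_le_one_left (norm_nonneg _) ht'.2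
    have h2 : ‖ext f (t * φ z)‖ ≤ M := by
      rw [ext_of_norm_lt _ (norm_ofReal_mul_lt ht' _)]
      exact hM _ h1
    have h3 := hB _ (mem_closedBall_zero_iff.2 h1)
    rw [norm_mul, norm_mul]
    exact (mul_le_of_le_one_right (by positivity) (φ z).norm_lt_one.le).trans
      (mul_le_mul h2 h3 (norm_nonneg _) hM0)

/-! ### Evaluation functionals and dilations -/

section Conditions

variable {X : Type*} [NormedAddCommGroup X] [NormedSpace ℂ X] {ι : X →ₗ[ℂ] HolD}

theorem map_sub_apply (f g : X) (z : 𝔻) : ι (f - g) z = ι f z - ι g z := by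
  rw [map_sub, HolD.sub_apply]

/-- Evaluation is jointly continuous, hence bounded on the product of the compact unit ball and a
compact subdisc; scaling does the rest. -/
theorem CondI.exists_bound (hI : CondI ι) {s : ℝ} (hs : s < 1) :
    ∃ M : ℝ, 0 ≤ M ∧ ∀ (f : X) (z : 𝔻), ‖(z : ℂ)‖ ≤ s → ‖ι f z‖ ≤ M * ‖f‖ := by
  obtain ⟨M, hM⟩ := (hI.prod (isCompact_norm_le hs)).exists_bound_of_continuousOn
    HolD.continuous_eval.continuousOn
  have key : ∀ (f : X) (z : 𝔻), ‖(z : ℂ)‖ ≤ s → ‖ι f z‖ ≤ M * ‖f‖ := fun f z hz => by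
    rcases eq_or_ne f 0 with rfl | hf
    · simp [HolD.zero_apply]
    · have hf' : 0 < ‖f‖ := norm_pos_iff.2 hf
      have h1 : ‖((‖f‖⁻¹ : ℝ) : ℂ) • f‖ ≤ 1 := by
        rw [norm_smul, Complex.norm_real, norm_inv, norm_norm, inv_mul_cancel₀ hf'.ne']
      have h2 := hM (ι (((‖f‖⁻¹ : ℝ) : ℂ) • f), z)
        ⟨⟨_, mem_closedBall_zero_iff.2 h1, rfl⟩, hz⟩
      simp only [map_smul, HolD.smul_apply, norm_mul, Complex.norm_real, norm_inv,
        norm_norm] at h2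
      rwa [inv_mul_le_iff₀ hf', mul_comm] at h2
  exact ⟨max M 0, le_max_right _ _, fun f z hz => (key f z hz).trans
    (mul_le_mul_of_nonneg_right (le_max_left _ _) (norm_nonneg _))⟩

theorem CondI.evalNorm_ne_top (hI : CondI ι) (z : 𝔻) : evalNorm ι z ≠ ∞ := by
  obtain ⟨M, hM0, hM⟩ := hI.exists_bound z.norm_lt_one
  refine ne_top_of_le_ne_top (ENNReal.ofReal_ne_top (r := M)) (iSup₂_le fun f hf => ?_)
  rw [← ofReal_norm]
  exact ENNReal.ofReal_le_ofReal ((hM f z le_rfl).trans (mul_le_of_le_one_right hM0 hf))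

theorem CondI.norm_apply_le (hI : CondI ι) (f : X) (z : 𝔻) :
    ‖ι f z‖ ≤ (evalNorm ι z).toReal * ‖f‖ := by
  rcases eq_or_ne f 0 with rfl | hf
  · simp [HolD.zero_apply]
  · have hf' : 0 < ‖f‖ := norm_pos_iff.2 hf
    have h1 : ‖((‖f‖⁻¹ : ℝ) : ℂ) • f‖ ≤ 1 := by
      rw [norm_smul, Complex.norm_real, norm_inv, norm_norm, inv_mul_cancel₀ hf'.ne']
    have h2 : ‖ι (((‖f‖⁻¹ : ℝ) : ℂ) • f) z‖ₑ ≤ evalNorm ι z :=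
      le_iSup₂ (f := fun (f : X) (_ : ‖f‖ ≤ 1) => ‖ι f z‖ₑ) _ h1
    have h3 := ENNReal.toReal_mono (hI.evalNorm_ne_top z) h2
    rw [toReal_enorm, map_smul, HolD.smul_apply, norm_mul, Complex.norm_real, norm_inv,
      norm_norm, inv_mul_le_iff₀ hf'] at h3
    linarith

theorem CondI.exists_lt_norm_apply (hI : CondI ι) {z : 𝔻} {a : ℝ} (ha0 : 0 ≤ a)
    (ha : a < (evalNorm ι z).toReal) : ∃ f : X, ‖f‖ ≤ 1 ∧ a < ‖ι f z‖ := by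
  have h1 : ENNReal.ofReal a < evalNorm ι z :=
    (ENNReal.ofReal_lt_iff_lt_toReal ha0 (hI.evalNorm_ne_top z)).2 ha
  simp only [evalNorm, lt_iSup_iff] at h1
  obtain ⟨f, hf, h⟩ := h1
  refine ⟨f, hf, ?_⟩
  rw [← ofReal_norm] at h
  exact (ENNReal.ofReal_lt_ofReal_iff_of_nonneg ha0).1 h

/-- Lets the compact operator of (III) and the uniformly bounded one of (IV) be treated as the same
operator. -/
theorem IsDilation.unique (hι : Function.Injective ι) {r : ℝ} {S S' : X →L[ℂ] X}
    (hS : IsDilation ι r S) (hS' : IsDilation ι r S') : S = S' := by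
  ext f
  apply hι
  apply Subtype.ext
  ext z
  exact (hS f z).trans (hS' f z).symm

/-- Conditions (III) and (IV) combined. -/
theorem exists_dilation_bound (hι : Function.Injective ι) (hIII : CondIII ι) (hIV : CondIV ι) :
    ∃ C : ℝ, 1 ≤ C ∧ ∀ r : ℝ, 0 < r → r < 1 →
      ∃ S : X →L[ℂ] X, IsDilation ι r S ∧ IsCompactOperator S ∧ ‖S‖ ≤ C := by
  obtain ⟨C, hC⟩ := hIV
  refine ⟨max C 1, le_max_right _ _, fun r h0 h1 => ?_⟩
  obtain ⟨S, hS, hSC⟩ := hC r h0 h1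
  obtain ⟨S', hS', hcomp⟩ := hIII r h0 h1
  obtain rfl := hS.unique hι hS'
  exact ⟨S, hS, hcomp, hSC.trans (le_max_left _ _)⟩

/-- A dilate only sees `f` on `|w| ≤ r`. The bound depends on `f` and `r`; uniformity comes later
from a finite net. -/
theorem IsDilation.exists_bound (hI : CondI ι) {r : ℝ} (h0 : 0 < r) (h1 : r < 1)
    {S : X →L[ℂ] X} (hS : IsDilation ι r S) (f : X) : ∃ M : ℝ, ∀ z, ‖ι (S f) z‖ ≤ M := by
  obtain ⟨M, -, hM⟩ := hI.exists_bound h1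
  refine ⟨M * ‖f‖, fun z => ?_⟩
  rw [hS, ext_of_norm_lt _ (norm_ofReal_mul_lt ⟨h0.le, h1.le⟩ z)]
  refine hM _ _ ?_
  rw [UnitDisc.coe_mk, norm_mul, Complex.norm_real, Real.norm_eq_abs, abs_of_pos h0]
  exact mul_le_of_le_one_right h0.le z.norm_lt_one.le

/-- `f(rw) → f(w)` as `r → 1`, uniformly in `|w| ≤ s` and in the unit ball of `X`. -/
theorem CondI.exists_dilation_sub_le (hI : CondI ι) {s : ℝ} (hs : s < 1) {ε : ℝ}
    (hε : 0 < ε) : ∃ r₀ : ℝ, r₀ < 1 ∧ ∀ r : ℝ, 0 < r → r₀ < r → r < 1 →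
      ∀ S : X →L[ℂ] X, IsDilation ι r S →
        ∀ (f : X) (w : 𝔻), ‖(w : ℂ)‖ ≤ s → ‖ι (f - S f) w‖ ≤ ε * ‖f‖ := by
  set ρ := (1 - s) / 2 with hρ
  have hρ0 : 0 < ρ := by linarith
  obtain ⟨M, hM0, hM⟩ := hI.exists_bound (s := s + ρ) (by linarith)
  have hpos : 0 < M / ρ + 1 := by positivity
  -- By Cauchy, `f` is Lipschitz with constant `M ‖f‖ / ρ` on `|w| ≤ s`, and `|w - r w| ≤ 1 - r`.
  -- The `+ 1` avoids dividing by zero.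
  refine ⟨1 - ε / (M / ρ + 1), by linarith [div_pos hε hpos], fun r hr0 hr hr1 S hS f w hw => ?_⟩
  have hlt := norm_ofReal_mul_lt ⟨hr0.le, hr1.le⟩ w
  have hd : ∀ u : 𝔻, ‖(u : ℂ)‖ ≤ s → ‖dd (ι f) u‖ ≤ M * ‖f‖ / ρ := fun u hu =>
    (ι f).norm_dd_le hρ0 (by linarith) fun y hy => hM f y (by linarith)
  have hrw : ‖((UnitDisc.mk (r * w) hlt : 𝔻) : ℂ)‖ ≤ s := by
    rw [UnitDisc.coe_mk, norm_mul, Complex.norm_real, Real.norm_eq_abs, abs_of_pos hr0]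
    exact (mul_le_of_le_one_left (norm_nonneg _) hr1.le).trans hw
  have h1 := (ι f).norm_sub_le hs hd hw hrw
  rw [map_sub_apply, hS, ext_of_norm_lt _ hlt]
  refine h1.trans ?_
  have h2 : ‖(w : ℂ) - (UnitDisc.mk (r * w) hlt : 𝔻)‖ ≤ 1 - r := by
    have : (w : ℂ) - (UnitDisc.mk (r * w) hlt : 𝔻) = ((1 - r : ℝ) : ℂ) * w := by
      rw [UnitDisc.coe_mk]
      push_cast
      ring
    rw [this, norm_mul, Complex.norm_real, Real.norm_eq_abs, abs_of_pos (by linarith)]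
    exact mul_le_of_le_one_right (by linarith) w.norm_lt_one.le
  have h3 : (1 - r) * (M / ρ + 1) ≤ ε := by
    rw [← le_div_iff₀ hpos]
    linarith
  have h4 : M / ρ * (1 - r) ≤ ε := by nlinarith
  calc M * ‖f‖ / ρ * ‖(w : ℂ) - (UnitDisc.mk (r * w) hlt : 𝔻)‖
      ≤ M * ‖f‖ / ρ * (1 - r) := by gcongr
    _ = M / ρ * (1 - r) * ‖f‖ := by ring
    _ ≤ ε * ‖f‖ := by gcongr

end Conditions

/-! ### Bloch norm estimates and essential norms -/

theorem Bloch.mul_norm_dd_le {v : Weight} (f : Bloch v) (z : 𝔻) :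
    v z * ‖dd f.toHolD z‖ ≤ ‖f‖ := by
  have h := le_ciSup f.bdd z
  have h0 := norm_nonneg (f.toHolD 0)
  rw [Bloch.norm_def]
  linarith

theorem Bloch.norm_le {v : Weight} (f : Bloch v) {a b : ℝ} (ha : ‖f.toHolD 0‖ ≤ a)
    (hb : ∀ z, v z * ‖dd f.toHolD z‖ ≤ b) : ‖f‖ ≤ a + b := by
  have : Nonempty 𝔻 := ⟨0⟩
  rw [Bloch.norm_def]
  exact add_le_add ha (ciSup_le hb)

section EssNorm

variable {X Y Z : Type*} [NormedAddCommGroup X] [NormedSpace ℂ X] [NormedAddCommGroup Y]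
  [NormedSpace ℂ Y] [NormedAddCommGroup Z] [NormedSpace ℂ Z]

theorem essNorm_le {T K : X →L[ℂ] Y} (hK : IsCompactOperator K) {a : ℝ} (h : ‖T - K‖ ≤ a) :
    essNorm T ≤ ENNReal.ofReal a := by
  refine (iInf₂_le K hK).trans ?_
  rw [← ofReal_norm]
  exact ENNReal.ofReal_le_ofReal h

theorem le_mul_essNorm {T : X →L[ℂ] Y} {c : ℝ≥0} (hc : 0 < c) {L : ℝ≥0∞}
    (h : ∀ K : X →L[ℂ] Y, IsCompactOperator K → L ≤ c * ‖T - K‖ₑ) : L ≤ c * essNorm T := by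
  rw [← ENNReal.div_le_iff' (by exact_mod_cast hc.ne') ENNReal.coe_ne_top]
  refine le_iInf₂ fun K hK => ?_
  rw [ENNReal.div_le_iff' (by exact_mod_cast hc.ne') ENNReal.coe_ne_top]
  exact h K hK

theorem essNorm_comp_le (J : Y →L[ℂ] Z) (T : X →L[ℂ] Y) {c : ℝ≥0} (hc : 0 < c)
    (hJ : ‖J‖ ≤ c) : essNorm (J.comp T) ≤ c * essNorm T := by
  refine le_mul_essNorm hc fun K hK => ?_
  refine (iInf₂_le (J.comp K) (hK.clm_comp J)).trans ?_
  rw [← ContinuousLinearMap.comp_sub, ← ofReal_norm, ← ofReal_norm, ← ENNReal.ofReal_coe_nnreal,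
    ← ENNReal.ofReal_mul c.coe_nonneg]
  refine ENNReal.ofReal_le_ofReal ((J.opNorm_comp_le _).trans ?_)
  gcongr

end EssNorm

/-! ### Two-sided estimate for Bloch-type targets -/

section Volterra

variable {X : Type*} [NormedAddCommGroup X] [NormedSpace ℂ X] {ι : X →ₗ[ℂ] HolD} {v : Weight}
  {g : HolD} {φ : 𝔻 → 𝔻} {T : X →L[ℂ] Bloch v}

theorem dd_apply (hφ : IsHol fun z => (φ z : ℂ))
    (hT : ∀ f z, (T f).toHolD z = volterra g φ (ι f) z) (f : X) (z : 𝔻) :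
    dd (T f).toHolD z = ι f (φ z) * dd (fun w => g (φ w)) z :=
  dd_volterra hφ (hT f) z

/-- The essential norm is bounded by the distance to the compact operators `T ∘ T_r`. -/
theorem essNorm_le_limsupAt (hconst : ContainsConstants ι) (hI : CondI ι) {C : ℝ} (hC1 : 1 ≤ C)
    (hC : ∀ r : ℝ, 0 < r → r < 1 →
      ∃ S : X →L[ℂ] X, IsDilation ι r S ∧ IsCompactOperator S ∧ ‖S‖ ≤ C)
    (hφ : IsHol fun z => (φ z : ℂ)) (hT : ∀ f z, (T f).toHolD z = volterra g φ (ι f) z)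
    {B : ℝ} (hB0 : 0 ≤ B)
    (hB : limsupAt φ (fun z =>
      ENNReal.ofReal (v z * ‖dd (fun w => g (φ w)) z‖) * evalNorm ι (φ z)) < ENNReal.ofReal B)
    {ε : ℝ} (hε : 0 < ε) : essNorm T ≤ ENNReal.ofReal ((1 + C) * B + ε) := by
  obtain ⟨t, ht, hts⟩ := mem_comap.1 (eventually_lt_of_limsup_lt hB)
  obtain ⟨s, hs0, hs1, hs⟩ := eventually_toBoundary ht
  -- Testing `T` on the constant 1 bounds `v |(g ∘ φ)'|` on the whole disc.
  obtain ⟨e, he⟩ := hconst 1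
  set N := ‖T e‖
  have hN : ∀ z, v z * ‖dd (fun w => g (φ w)) z‖ ≤ N := fun z => by
    have h := (T e).mul_norm_dd_le z
    rwa [dd_apply hφ hT, he, one_mul] at h
  have hN0 : 0 ≤ N := norm_nonneg _
  obtain ⟨D, hD0, hD⟩ := exists_norm_volterra_le g φ 0
  -- The error `η ‖f‖` enters twice: with factor `D` in the value at 0 and with factor `N` in the
  -- derivative.
  set η := ε / (N + D + 1) with hη
  have hη0 : 0 < η := by positivity
  -- `(T f)(0)` is an integral up to `φ(0)`, which need not be 0, so the subdisc must contain that
  -- point too.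
  set s' := max s ‖(φ 0 : ℂ)‖ with hs'
  obtain ⟨r₀, hr₀, hr⟩ := hI.exists_dilation_sub_le (s := s') (max_lt hs1 (φ 0).norm_lt_one) hη0
  obtain ⟨r, hr1, hr2⟩ := exists_between (max_lt hr₀ one_pos)
  have hrpos := (le_max_right _ _).trans_lt hr1
  obtain ⟨S, hS, hScomp, hSC⟩ := hC r hrpos hr2
  have hsmall := hr r hrpos ((le_max_left _ _).trans_lt hr1) hr2 S hS
  refine essNorm_le (K := T.comp S) (hScomp.clm_comp T) ?_
  refine ContinuousLinearMap.opNorm_le_bound _ (by positivity) fun f => ?_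
  have hTf : (T - T.comp S) f = T (f - S f) := by simp
  have hf0 := norm_nonneg f
  have hsum : η * D + η * N ≤ ε := by
    have : η * (N + D + 1) = ε := div_mul_cancel₀ _ (by positivity)
    nlinarith
  rw [hTf]
  refine ((T (f - S f)).norm_le (a := η * ‖f‖ * D) (b := (1 + C) * B * ‖f‖ + N * (η * ‖f‖))
    ?_ fun z => ?_).trans ?_
  · rw [hT]
    exact hD _ _ fun w hw => hsmall f w (hw.trans (le_max_right _ _))
  · rw [dd_apply hφ hT, norm_mul]
    have hv : 0 ≤ v z * ‖dd (fun w => g (φ w)) z‖ := mul_nonneg (v.pos z).le (norm_nonneg _)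
    have hBC : 0 ≤ (1 + C) * B * ‖f‖ := by positivity
    by_cases hz : ‖(φ z : ℂ)‖ ≤ s
    · have h1 := hsmall f (φ z) (hz.trans (le_max_left _ _))
      calc v z * (‖ι (f - S f) (φ z)‖ * ‖dd (fun w => g (φ w)) z‖)
          = v z * ‖dd (fun w => g (φ w)) z‖ * ‖ι (f - S f) (φ z)‖ := by ring
        _ ≤ N * (η * ‖f‖) := mul_le_mul (hN z) h1 (norm_nonneg _) hN0
        _ ≤ _ := by linarith
    · have h1 : ENNReal.ofReal (v z * ‖dd (fun w => g (φ w)) z‖) * evalNorm ι (φ z) <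
          ENNReal.ofReal B := hts (hs (φ z) (not_le.1 hz))
      rw [← ENNReal.ofReal_toReal (hI.evalNorm_ne_top (φ z)), ← ENNReal.ofReal_mul hv] at h1
      have h2 := ((ENNReal.ofReal_lt_ofReal_iff_of_nonneg (by positivity)).1 h1).le
      have h3 := hI.norm_apply_le (f - S f) (φ z)
      have h4 : ‖f - S f‖ ≤ (1 + C) * ‖f‖ := by
        have h5 := norm_sub_le f (S f)
        have h6 := (S.le_opNorm f).trans (mul_le_mul_of_nonneg_right hSC hf0)
        linarith
      calc v z * (‖ι (f - S f) (φ z)‖ * ‖dd (fun w => g (φ w)) z‖)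
          = v z * ‖dd (fun w => g (φ w)) z‖ * ‖ι (f - S f) (φ z)‖ := by ring
        _ ≤ v z * ‖dd (fun w => g (φ w)) z‖ *
            ((evalNorm ι (φ z)).toReal * ((1 + C) * ‖f‖)) := by
          gcongr
          exact h3.trans (by gcongr)
        _ = v z * ‖dd (fun w => g (φ w)) z‖ * (evalNorm ι (φ z)).toReal * ((1 + C) * ‖f‖) := by
          ring
        _ ≤ B * ((1 + C) * ‖f‖) := by gcongr
        _ ≤ (1 + C) * B * ‖f‖ + N * (η * ‖f‖) := by
          have : 0 ≤ N * (η * ‖f‖) := by positivity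
          linarith
  · have := mul_le_mul_of_nonneg_right hsum hf0
    linarith

/-- A relatively compact set of images of dilated functions has a finite net consisting of images
of functions with a common bound on the disc. -/
theorem exists_bounded_net (hI : CondI ι) {C : ℝ}
    {K : X →L[ℂ] Bloch v} (hK : IsCompactOperator K) {ε : ℝ} (hε : 0 < ε) :
    ∃ M : ℝ, ∀ (r : ℝ) (S : X →L[ℂ] X) (f : X), 0 < r → r < 1 → IsDilation ι r S →
      ‖S f‖ ≤ C → ∃ h : X, ‖h‖ ≤ C ∧ ‖K (S f) - K h‖ < ε ∧ ∀ z, ‖ι h z‖ ≤ M := by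
  -- Here `M` may vary with `h`. The net is chosen inside `K '' A`, so each of its finitely many
  -- centres is the image of a bounded function.
  set A : Set X := {h | ‖h‖ ≤ C ∧ ∃ M : ℝ, ∀ z, ‖ι h z‖ ≤ M}
  have hA : TotallyBounded (K '' A) :=
    (hK.isCompact_closure_image_closedBall C).totallyBounded.subset
      ((Set.image_mono fun h hh => mem_closedBall_zero_iff.2 hh.1).trans subset_closure)
  obtain ⟨t, htA, htfin, ht⟩ := Metric.finite_approx_of_totallyBounded hA ε hε
  have hex : ∀ y, ∃ (h : X) (M : ℝ), y ∈ t → K h = y ∧ ‖h‖ ≤ C ∧ ∀ z, ‖ι h z‖ ≤ M := fun y => by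
    by_cases hy : y ∈ t
    · obtain ⟨h, ⟨hC, M, hM⟩, hKh⟩ := htA hy
      exact ⟨h, M, fun _ => ⟨hKh, hC, hM⟩⟩
    · exact ⟨0, 0, fun h => absurd h hy⟩
  choose h m hm using hex
  obtain ⟨M, hM⟩ := (htfin.image m).bddAbove
  refine ⟨M, fun r S f h0 h1 hS hSf => ?_⟩
  have hmem : K (S f) ∈ K '' A := ⟨S f, ⟨hSf, hS.exists_bound hI h0 h1 f⟩, rfl⟩
  obtain ⟨y, hy, hball⟩ := Set.mem_iUnion₂.1 (ht hmem)
  obtain ⟨hKh, hhC, hhM⟩ := hm y hy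
  refine ⟨h y, hhC, ?_, fun z => (hhM z).trans (hM ⟨y, hy, rfl⟩)⟩
  rw [hKh]
  exact mem_ball_iff_norm.1 hball

/-- Dilating a nearly extremal function makes it bounded; by continuity at `a`, its value there
stays above `b` for `r` close to 1. -/
theorem exists_dilation_norm_apply_gt (hI : CondI ι) {C : ℝ}
    (hC : ∀ r : ℝ, 0 < r → r < 1 →
      ∃ S : X →L[ℂ] X, IsDilation ι r S ∧ IsCompactOperator S ∧ ‖S‖ ≤ C) {a : 𝔻} {b : ℝ}
    (hb0 : 0 ≤ b) (hb : b < (evalNorm ι a).toReal) :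
    ∃ (r : ℝ) (S : X →L[ℂ] X) (f : X), 0 < r ∧ r < 1 ∧ IsDilation ι r S ∧ ‖S f‖ ≤ C ∧
      b < ‖ι (S f) a‖ := by
  obtain ⟨f, hf, hfa⟩ := hI.exists_lt_norm_apply hb0 hb
  have hcont : ContinuousAt (fun r : ℝ => ‖ext (ι f) (r * a)‖) 1 := by
    have h1 : ContinuousAt (ext (ι f)) (((1 : ℝ) : ℂ) * a) := by
      rw [Complex.ofReal_one, one_mul]
      exact ((ι f).differentiableAt a).continuousAt
    exact (ContinuousAt.comp (f := fun r : ℝ => (r : ℂ) * a) h1 (by fun_prop)).norm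
  have hlim : b < ‖ext (ι f) (((1 : ℝ) : ℂ) * a)‖ := by
    rwa [Complex.ofReal_one, one_mul, ext_coe]
  have hev : ∀ᶠ r : ℝ in 𝓝[<] 1, b < ‖ext (ι f) (r * a)‖ :=
    (hcont.eventually_const_lt hlim).filter_mono nhdsWithin_le_nhds
  obtain ⟨r, hr, hr0, hr1⟩ := (hev.and (Ioo_mem_nhdsLT one_pos)).exists
  obtain ⟨S, hS, -, hSC⟩ := hC r hr0 hr1
  refine ⟨r, S, f, hr0, hr1, hS, ?_, by rwa [hS]⟩
  exact (S.le_opNorm f).trans ((mul_le_of_le_one_right (norm_nonneg S) hf).trans hSC)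

/-- The net, and hence `M`, is fixed before the point `z`; this is what allows `‖δ_{φ(z)}‖` to be
taken large compared with `M`. -/
theorem limsupAt_le_of_isCompactOperator (hI : CondI ι) (hII : CondII ι) {C : ℝ} (hC1 : 1 ≤ C)
    (hC : ∀ r : ℝ, 0 < r → r < 1 →
      ∃ S : X →L[ℂ] X, IsDilation ι r S ∧ IsCompactOperator S ∧ ‖S‖ ≤ C)
    (hφ : IsHol fun z => (φ z : ℂ)) (hT : ∀ f z, (T f).toHolD z = volterra g φ (ι f) z)
    {K : X →L[ℂ] Bloch v} (hK : IsCompactOperator K) :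
    limsupAt φ (fun z =>
      ENNReal.ofReal (v z * ‖dd (fun w => g (φ w)) z‖) * evalNorm ι (φ z)) ≤
        ENNReal.ofReal (8 * C * ‖T - K‖) := by
  refine ENNReal.le_of_forall_pos_le_add fun ε hε _ => ?_
  have hε' : (0 : ℝ) < ε := hε
  by_contra! hlt
  obtain ⟨M, hM⟩ := exists_bounded_net (C := C) hI hK (ε := ε / 4) (by positivity)
  -- With `d = ‖δ_{φ(z)}‖ > 4|M| + 1`, a value above `d/2` stays above `d/4` after subtracting `h`,
  -- as `|h| ≤ M`.
  have hbig : ∀ᶠ z in comap φ toBoundary, ENNReal.ofReal (4 * |M| + 1) < evalNorm ι (φ z) :=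
    (hII.eventually (lt_mem_nhds ENNReal.ofReal_lt_top)).comap φ
  obtain ⟨z, hz, hzM⟩ := ((frequently_lt_of_lt_limsup (by isBoundedDefault) hlt).and_eventually
    hbig).exists
  set d := (evalNorm ι (φ z)).toReal with hd
  set p := v z * ‖dd (fun w => g (φ w)) z‖ with hp
  have hp0 : 0 ≤ p := mul_nonneg (v.pos z).le (norm_nonneg _)
  have hdtop := hI.evalNorm_ne_top (φ z)
  rw [← ENNReal.ofReal_toReal hdtop] at hz hzM
  have hTK := norm_nonneg (T - K)
  rw [← ENNReal.ofReal_mul hp0, ← ENNReal.ofReal_coe_nnreal,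
    ← ENNReal.ofReal_add (by positivity) hε'.le,
    ENNReal.ofReal_lt_ofReal_iff_of_nonneg (by positivity)] at hz
  rw [ENNReal.ofReal_lt_ofReal_iff_of_nonneg (by positivity)] at hzM
  have hM0 := abs_nonneg M
  have hd0 : 0 < d := by linarith
  obtain ⟨r, S, f, hr0, hr1, hS, hSf, hgt⟩ :=
    exists_dilation_norm_apply_gt hI hC (b := d / 2) (by linarith)
      (by linarith : d / 2 < (evalNorm ι (φ z)).toReal)
  obtain ⟨h, hhC, hKh, hhM⟩ := hM r S f hr0 hr1 hS hSf
  have h1 := (T (S f - h)).mul_norm_dd_le z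
  rw [dd_apply hφ hT, norm_mul, map_sub_apply] at h1
  have h2 : d / 4 ≤ ‖ι (S f) (φ z) - ι h (φ z)‖ := by
    have h3 := norm_sub_norm_le (ι (S f) (φ z)) (ι h (φ z))
    have h4 := (hhM (φ z)).trans (le_abs_self M)
    linarith
  have h5 : ‖T (S f - h)‖ ≤ ‖T - K‖ * (2 * C) + ε / 4 := by
    have h6 : T (S f - h) = (T - K) (S f - h) + (K (S f) - K h) := by
      simp only [sub_apply, map_sub]
      abel
    have h7 := (T - K).le_opNorm (S f - h)
    have h8 : ‖S f - h‖ ≤ 2 * C := (norm_sub_le _ _).trans (by linarith)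
    have h9 := mul_le_mul_of_nonneg_left h8 hTK
    rw [h6]
    exact (norm_add_le _ _).trans (by linarith)
  have h10 : p * (d / 4) ≤ v z * (‖ι (S f) (φ z) - ι h (φ z)‖ * ‖dd (fun w => g (φ w)) z‖) :=
    (mul_le_mul_of_nonneg_left h2 hp0).trans (le_of_eq (by ring))
  -- Altogether `p d / 4 ≤ 2C ‖T - K‖ + ε/4`; multiplying by 4 gives the constant `8C` and
  -- contradicts `hz`.
  linarith

/-- The essential norm of the Volterra operator into Bloch-type spaces. -/
theorem exists_essNorm_bloch_equiv (hι : Function.Injective ι) (hconst : ContainsConstants ι)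
    (hI : CondI ι) (hII : CondII ι) (hIII : CondIII ι) (hIV : CondIV ι) :
    ∃ c : ℝ≥0, 0 < c ∧ ∀ (v : Weight) (g : HolD) (φ : 𝔻 → 𝔻), IsHol (fun z => (φ z : ℂ)) →
      ∀ T : X →L[ℂ] Bloch v, (∀ f z, (T f).toHolD z = volterra g φ (ι f) z) →
        essNorm T ≤ c * limsupAt φ (fun z =>
          ENNReal.ofReal (v z * ‖dd (fun w => g (φ w)) z‖) * evalNorm ι (φ z)) ∧
        limsupAt φ (fun z =>
          ENNReal.ofReal (v z * ‖dd (fun w => g (φ w)) z‖) * evalNorm ι (φ z)) ≤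
            c * essNorm T := by
  obtain ⟨C, hC1, hC⟩ := exists_dilation_bound hι hIII hIV
  have hC8 : 0 < 8 * C := by linarith
  have hc : 0 < (8 * C).toNNReal := Real.toNNReal_pos.2 hC8
  refine ⟨(8 * C).toNNReal, hc, fun v g φ hφ T hT => ⟨?_, le_mul_essNorm hc fun K hK => ?_⟩⟩
  · set L := limsupAt φ (fun z =>
      ENNReal.ofReal (v z * ‖dd (fun w => g (φ w)) z‖) * evalNorm ι (φ z)) with hL
    rcases eq_or_ne L ∞ with hLtop | hLtop
    · rw [hLtop, ENNReal.mul_top (by exact_mod_cast hc.ne')]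
      exact le_top
    refine ENNReal.le_of_forall_pos_le_add fun ε hε _ => ?_
    have hε' : (0 : ℝ) < ε := hε
    have hL0 : 0 ≤ L.toReal := ENNReal.toReal_nonneg
    -- The strict bound `B` must exceed the limsup; the excess costs `(1 + C) δ = ε/2`.
    set δ := (ε : ℝ) / (2 * (1 + C)) with hδ
    have hδ0 : 0 < δ := by positivity
    have h := essNorm_le_limsupAt hconst hI hC1 hC hφ hT (B := L.toReal + δ) (by positivity)
      (by
        rw [← hL]
        exact (ENNReal.lt_ofReal_iff_toReal_lt hLtop).2 (by linarith)) (half_pos hε')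
    refine h.trans ?_
    have hcL : ((8 * C).toNNReal : ℝ≥0∞) * L = ENNReal.ofReal (8 * C * L.toReal) := by
      rw [ENNReal.ofReal_mul hC8.le, ENNReal.ofReal_toReal hLtop]
      rfl
    rw [hcL, ← ENNReal.ofReal_coe_nnreal, ← ENNReal.ofReal_add (by positivity) hε'.le]
    refine ENNReal.ofReal_le_ofReal ?_
    have h1 : (1 + C) * δ = ε / 2 := by
      rw [hδ]
      field_simp
    have h2 : (1 + C) * L.toReal ≤ 8 * C * L.toReal := by gcongr; linarith
    linarith
  · refine (limsupAt_le_of_isCompactOperator hI hII hC1 hC hφ hT hK).trans (le_of_eq ?_)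
    rw [ENNReal.ofReal_mul hC8.le, ofReal_norm]
    rfl

end Volterra

/-! ### Normal weights -/

theorem norm_dyadic (n : ℕ) : ‖(dyadic n : ℂ)‖ = 1 - (1 / 2) ^ n := by
  have h : ((1 : ℝ) / 2) ^ n ≤ 1 := pow_le_one₀ (by norm_num) (by norm_num)
  rw [dyadic, UnitDisc.coe_mk, Complex.norm_real, Real.norm_eq_abs, abs_of_nonneg (by linarith)]

theorem norm_dyadic_succ (n : ℕ) :
    ‖(dyadic (n + 1) : ℂ)‖ = ‖(dyadic n : ℂ)‖ + (1 / 2) ^ (n + 1) := by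
  rw [norm_dyadic, norm_dyadic, pow_succ]
  ring

theorem norm_dyadic_mono : Monotone fun n => ‖(dyadic n : ℂ)‖ :=
  monotone_nat_of_le_succ fun n => by
    rw [norm_dyadic_succ]
    have : (0 : ℝ) < (1 / 2) ^ (n + 1) := by positivity
    linarith

theorem exists_dyadic_le_le (z : 𝔻) :
    ∃ n, ‖(dyadic n : ℂ)‖ ≤ ‖(z : ℂ)‖ ∧ ‖(z : ℂ)‖ ≤ ‖(dyadic (n + 1) : ℂ)‖ := by
  have hex : ∃ n, ‖(z : ℂ)‖ ≤ ‖(dyadic (n + 1) : ℂ)‖ := by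
    obtain ⟨n, hn⟩ := exists_pow_lt_of_lt_one (sub_pos.2 z.norm_lt_one)
      (by norm_num : (1 / 2 : ℝ) < 1)
    refine ⟨n, le_trans ?_ (norm_dyadic_mono n.le_succ)⟩
    simp only [norm_dyadic]
    linarith
  classical
  refine ⟨Nat.find hex, ?_, Nat.find_spec hex⟩
  rcases h : Nat.find hex with _ | m
  · rw [norm_dyadic]
    simp
  · exact (not_le.1 (Nat.find_min hex (m := m) (by omega))).le

/-- Partial sums of a positive increasing sequence of geometric growth are bounded by a multiple
of the last term. -/
theorem exists_sum_range_le_mul {a : ℕ → ℝ} (hpos : ∀ n, 0 < a n) (hmono : Monotone a) {q : ℝ}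
    (hq : q < 1) {k N : ℕ} (h : ∀ n, N ≤ n → a n ≤ q * a (n + k)) :
    ∃ C : ℝ, 0 ≤ C ∧ ∀ n, ∑ j ∈ Finset.range (n + 1), a j ≤ C * a n := by
  have hk : k ≠ 0 := by
    rintro rfl
    have h1 := h N le_rfl
    have h2 := hpos N
    rw [add_zero] at h1
    nlinarith
  -- The first entry covers `n < N + k` by counting terms. The second gives `C q + k ≤ C`, which
  -- closes the induction from `m` to `m + k`.
  set C : ℝ := max (N + k) (k / (1 - q))
  have hC1 : (N + k : ℝ) ≤ C := le_max_left _ _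
  have hC2 : (k : ℝ) ≤ C * (1 - q) := by
    rw [← div_le_iff₀ (by linarith)]
    exact le_max_right _ _
  have hC0 : 0 ≤ C := by
    refine le_trans ?_ hC1
    positivity
  refine ⟨C, hC0, fun n => ?_⟩
  induction n using Nat.strong_induction_on with
  | _ n ih =>
    rcases lt_or_ge n (N + k) with hn | hn
    · have h1 := Finset.sum_le_card_nsmul (Finset.range (n + 1)) a (a n)
        fun j hj => hmono (by have := Finset.mem_range.1 hj; omega)
      rw [Finset.card_range, nsmul_eq_mul] at h1
      refine h1.trans (mul_le_mul_of_nonneg_right (le_trans ?_ hC1) (hpos n).le)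
      exact_mod_cast hn
    · obtain ⟨m, rfl⟩ : ∃ m, n = m + k := ⟨n - k, by omega⟩
      have h1 := ih m (by omega)
      have h2 := h m (by omega)
      have h3 : ∑ j ∈ Finset.range k, a (m + 1 + j) ≤ k * a (m + k) := by
        have := Finset.sum_le_card_nsmul (Finset.range k) (fun j => a (m + 1 + j)) (a (m + k))
          fun j hj => hmono (by have := Finset.mem_range.1 hj; omega)
        simpa using this
      have h4 := hpos (m + k)
      rw [show m + k + 1 = (m + 1) + k by ring, Finset.sum_range_add]
      have h5 := mul_le_mul_of_nonneg_left h2 hC0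
      have h6 := mul_le_mul_of_nonneg_right hC2 h4.le
      linarith

namespace Weight.IsNormal

variable {v : Weight}

theorem exists_le_mul_succ (hv : v.IsNormal) :
    ∃ D : ℝ, 0 < D ∧ ∀ n, v (dyadic n) ≤ D * v (dyadic (n + 1)) := by
  set E := ⨆ n : ℕ, ENNReal.ofReal (v (dyadic n) / v (dyadic (n + 1)))
  have hE : E ≠ ∞ := hv.sup_lt_top.ne
  refine ⟨E.toReal + 1, by positivity, fun n => ?_⟩
  have h1 : ENNReal.ofReal (v (dyadic n) / v (dyadic (n + 1))) ≤ E :=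
    le_iSup (fun n : ℕ => ENNReal.ofReal (v (dyadic n) / v (dyadic (n + 1)))) n
  have h2 := (ENNReal.ofReal_le_iff_le_toReal hE).1 h1
  have h3 := v.pos (dyadic (n + 1))
  rw [div_le_iff₀ h3] at h2
  linarith

theorem exists_le_mul_add (hv : v.IsNormal) :
    ∃ (q : ℝ) (k N : ℕ), q < 1 ∧ ∀ n, N ≤ n → v (dyadic (n + k)) ≤ q * v (dyadic n) := by
  obtain ⟨k, hk⟩ := iInf_lt_iff.1 hv.inf_limsup_lt_one
  obtain ⟨q, hq1, hq2⟩ := ENNReal.lt_iff_exists_real_btwn.1 hk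
  obtain ⟨N, hN⟩ := eventually_atTop.1 (eventually_lt_of_limsup_lt hq2.1)
  refine ⟨q, k, N, ?_, fun n hn => ?_⟩
  · have := hq2.2
    rwa [← ENNReal.ofReal_one, ENNReal.ofReal_lt_ofReal_iff one_pos] at this
  · have h1 := ((ENNReal.ofReal_le_ofReal_iff hq1).1 (hN n hn).le)
    rwa [div_le_iff₀ (v.pos _)] at h1

/-- The infimum condition of normality says that `1/v` grows geometrically along the dyadic points,
in steps of length `k`. -/
theorem exists_sum_inv_le (hv : v.IsNormal) : ∃ C : ℝ, 0 ≤ C ∧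
    ∀ n, ∑ j ∈ Finset.range (n + 1), (v (dyadic j))⁻¹ ≤ C * (v (dyadic n))⁻¹ := by
  obtain ⟨q, k, N, hq, h⟩ := hv.exists_le_mul_add
  refine exists_sum_range_le_mul (fun n => inv_pos.2 (v.pos _)) (fun m n hmn => ?_) hq
    (k := k) (N := N) fun n hn => ?_
  · exact inv_anti₀ (v.pos _) (hv.antitone _ _ (norm_dyadic_mono hmn))
  · have h1 := v.pos (dyadic n)
    have h2 := v.pos (dyadic (n + k))
    rw [← div_eq_mul_inv, inv_eq_one_div, div_le_div_iff₀ h1 h2]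
    linarith [h n hn]

/-- Cauchy's estimate with radius `(1 - |z|)/2`; the supremum condition of normality makes `v`
comparable to `v(z)` from below on that disc. -/
theorem exists_norm_dd_le (hv : v.IsNormal) : ∃ C : ℝ, 0 ≤ C ∧ ∀ (f : HolD) (A : ℝ),
    (∀ z, v z * ‖f z‖ ≤ A) → ∀ z : 𝔻, (1 - ‖(z : ℂ)‖) * v z * ‖dd f z‖ ≤ C * A := by
  obtain ⟨D, hD, hvD⟩ := hv.exists_le_mul_succ
  refine ⟨2 * D ^ 2, by positivity, fun f A hA z => ?_⟩
  obtain ⟨n, hn, hn'⟩ := exists_dyadic_le_le z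
  have hz := z.norm_lt_one
  have hvz := v.pos z
  have hvz2 : v z ≤ D ^ 2 * v (dyadic (n + 2)) := by
    have h1 := hv.antitone _ _ hn
    have h2 := mul_le_mul_of_nonneg_left (hvD (n + 1)) hD.le
    have h3 := hvD n
    rw [pow_two]
    linarith
  -- From `|z| ≤ 1 - 2^{-(n+1)}` the disc stays in `|w| ≤ 1 - 2^{-(n+2)}`: two dyadic steps from
  -- `dyadic n`, hence `D ^ 2`.
  have hf : ∀ w : 𝔻, ‖(w : ℂ)‖ ≤ ‖(z : ℂ)‖ + (1 - ‖(z : ℂ)‖) / 2 → ‖f w‖ ≤ D ^ 2 * A / v z := by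
    intro w hw
    have hw2 : ‖(w : ℂ)‖ ≤ ‖(dyadic (n + 2) : ℂ)‖ := by
      rw [norm_dyadic] at hn' ⊢
      rw [pow_succ (1 / 2 : ℝ) (n + 1)]
      linarith
    have h1 := hv.antitone _ _ hw2
    rw [le_div_iff₀ hvz]
    calc ‖f w‖ * v z ≤ ‖f w‖ * (D ^ 2 * v w) := by
          gcongr
          exact hvz2.trans (by gcongr)
      _ = D ^ 2 * (v w * ‖f w‖) := by ring
      _ ≤ D ^ 2 * A := by
          gcongr
          exact hA w
  have h := f.norm_dd_le (ρ := (1 - ‖(z : ℂ)‖) / 2) (by linarith) (by linarith) hf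
  rw [le_div_iff₀ (by linarith), le_div_iff₀ hvz] at h
  linarith

/-- Radial integration over dyadic annuli. -/
theorem norm_apply_le_sum (hv : v.IsNormal) {f : HolD} {A : ℝ}
    (hA : ∀ z : 𝔻, (1 - ‖(z : ℂ)‖) * v z * ‖dd f z‖ ≤ A) (n : ℕ) :
    ∀ z : 𝔻, ‖(z : ℂ)‖ ≤ ‖(dyadic n : ℂ)‖ →
      ‖f z‖ ≤ ‖f 0‖ + A * ∑ j ∈ Finset.range (n + 1), (v (dyadic j))⁻¹ := by
  have hA0 : 0 ≤ A := le_trans (mul_nonneg (mul_nonneg (by simp) (v.pos 0).le) (norm_nonneg _))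
    (hA 0)
  induction n with
  | zero =>
    intro z hz
    rw [norm_dyadic, pow_zero, sub_self] at hz
    have hz0 : z = 0 := UnitDisc.coe_injective (norm_le_zero_iff.1 hz)
    subst hz0
    have : 0 ≤ A * ∑ j ∈ Finset.range (0 + 1), (v (dyadic j))⁻¹ :=
      mul_nonneg hA0 (Finset.sum_nonneg fun j _ => (inv_pos.2 (v.pos _)).le)
    linarith
  | succ n ih =>
    intro z hz
    have hvn := v.pos (dyadic (n + 1))
    have hpow : (0 : ℝ) < (1 / 2) ^ (n + 1) := by positivity
    -- `w` is the radial projection of `z` onto the smaller disc. The annulus has width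
    -- `2^{-(n+1)}`, which cancels the factor `1 - |u|` in the derivative bound.
    obtain ⟨w, hw, hzw⟩ : ∃ w : 𝔻, ‖(w : ℂ)‖ ≤ ‖(dyadic n : ℂ)‖ ∧
        ‖(z : ℂ) - w‖ ≤ (1 / 2) ^ (n + 1) := by
      rcases le_or_gt ‖(z : ℂ)‖ ‖(dyadic n : ℂ)‖ with h | h
      · exact ⟨z, h, by simp⟩
      · set ρ := ‖(dyadic n : ℂ)‖
        have hρ : 0 ≤ ρ := norm_nonneg _
        have hz0 : 0 < ‖(z : ℂ)‖ := hρ.trans_lt h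
        set t := ρ / ‖(z : ℂ)‖ with ht
        have ht01 : t ∈ Set.Icc (0 : ℝ) 1 := ⟨by positivity, by rw [div_le_one hz0]; exact h.le⟩
        have htz : t * ‖(z : ℂ)‖ = ρ := div_mul_cancel₀ _ hz0.ne'
        refine ⟨UnitDisc.mk (t * z) (norm_ofReal_mul_lt ht01 z), ?_, ?_⟩
        · rw [UnitDisc.coe_mk, norm_mul, Complex.norm_real, Real.norm_eq_abs,
            abs_of_nonneg ht01.1, htz]
        · have h1 : (z : ℂ) - t * z = ((1 - t : ℝ) : ℂ) * z := by
            push_cast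
            ring
          rw [UnitDisc.coe_mk, h1, norm_mul, Complex.norm_real, Real.norm_eq_abs,
            abs_of_nonneg (by linarith [ht01.2]), sub_mul, htz]
          rw [norm_dyadic_succ] at hz
          linarith
    have hd : ∀ u : 𝔻, ‖(u : ℂ)‖ ≤ ‖(dyadic (n + 1) : ℂ)‖ →
        ‖dd f u‖ ≤ A / ((1 / 2) ^ (n + 1) * v (dyadic (n + 1))) := fun u hu => by
      rw [le_div_iff₀ (by positivity)]
      have h1 := hv.antitone _ _ hu
      have h2 : (1 / 2) ^ (n + 1) ≤ 1 - ‖(u : ℂ)‖ := by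
        rw [norm_dyadic] at hu
        linarith
      calc ‖dd f u‖ * ((1 / 2) ^ (n + 1) * v (dyadic (n + 1)))
          ≤ ‖dd f u‖ * ((1 - ‖(u : ℂ)‖) * v u) :=
            mul_le_mul_of_nonneg_left (mul_le_mul h2 h1 hvn.le (by linarith)) (norm_nonneg _)
        _ = (1 - ‖(u : ℂ)‖) * v u * ‖dd f u‖ := by ring
        _ ≤ A := hA u
    have h1 := f.norm_sub_le (dyadic (n + 1)).norm_lt_one hd hz
      (hw.trans (norm_dyadic_mono n.le_succ))
    have h2 : A / ((1 / 2) ^ (n + 1) * v (dyadic (n + 1))) * ‖(z : ℂ) - w‖ ≤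
        A * (v (dyadic (n + 1)))⁻¹ := by
      calc _ ≤ A / ((1 / 2) ^ (n + 1) * v (dyadic (n + 1))) * (1 / 2) ^ (n + 1) := by gcongr
        _ = A * (v (dyadic (n + 1)))⁻¹ := by field_simp
    have h3 := ih w hw
    have h4 := norm_sub_norm_le (f z) (f w)
    rw [Finset.sum_range_succ, mul_add]
    linarith

/-- The sum from radial integration is dominated by its last term `1/v(dyadic (n + 1))`, which
`v(z)` cancels up to the factor `D`. -/
theorem exists_norm_apply_le (hv : v.IsNormal) : ∃ C : ℝ, 0 ≤ C ∧ ∀ (f : HolD) (A : ℝ),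
    (∀ z : 𝔻, (1 - ‖(z : ℂ)‖) * v z * ‖dd f z‖ ≤ A) → ∀ z, v z * ‖f z‖ ≤ C * (‖f 0‖ + A) := by
  obtain ⟨D, hD, hvD⟩ := hv.exists_le_mul_succ
  obtain ⟨C, hC, hvC⟩ := hv.exists_sum_inv_le
  have hv0 := v.pos 0
  refine ⟨v 0 + D * C, by positivity, fun f A hA z => ?_⟩
  have hA0 : 0 ≤ A := le_trans (mul_nonneg (mul_nonneg (by simp) hv0.le) (norm_nonneg _)) (hA 0)
  obtain ⟨n, hn, hn'⟩ := exists_dyadic_le_le z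
  have hvn := v.pos (dyadic (n + 1))
  have h1 := hv.norm_apply_le_sum hA (n + 1) z hn'
  have h2 := hv.antitone _ _ hn
  have h3 : v z ≤ v 0 := hv.antitone 0 z (by simp)
  have h4 : v z * ∑ j ∈ Finset.range (n + 1 + 1), (v (dyadic j))⁻¹ ≤ D * C := by
    calc v z * ∑ j ∈ Finset.range (n + 1 + 1), (v (dyadic j))⁻¹
        ≤ D * v (dyadic (n + 1)) * (C * (v (dyadic (n + 1)))⁻¹) :=
          mul_le_mul (h2.trans (hvD n)) (hvC (n + 1))
            (Finset.sum_nonneg fun j _ => (inv_pos.2 (v.pos _)).le) (by positivity)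
      _ = D * C := by field_simp
  have h5 := norm_nonneg (f 0)
  calc v z * ‖f z‖
      ≤ v z * (‖f 0‖ + A * ∑ j ∈ Finset.range (n + 1 + 1), (v (dyadic j))⁻¹) :=
        mul_le_mul_of_nonneg_left h1 (v.pos z).le
    _ = v z * ‖f 0‖ + A * (v z * ∑ j ∈ Finset.range (n + 1 + 1), (v (dyadic j))⁻¹) := by ring
    _ ≤ v 0 * ‖f 0‖ + A * (D * C) := by gcongr
    _ ≤ (v 0 + D * C) * (‖f 0‖ + A) := by
        have : 0 ≤ v 0 * A + D * C * ‖f 0‖ := by positivity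
        linarith

end Weight.IsNormal

/-! ### Identification of `H_v^∞` with a Bloch-type space -/

/-- The weight `(1 - |z|) v(z)`. -/
def Weight.distMul (v : Weight) : Weight where
  toFun z := (1 - ‖(z : ℂ)‖) * v z
  continuous_toFun :=
    (continuous_const.sub UnitDisc.continuous_coe.norm).mul v.continuous_toFun
  pos z := mul_pos (sub_pos.2 z.norm_lt_one) (v.pos z)
  tendsto_zero := by
    refine squeeze_zero (fun z => mul_nonneg (sub_nonneg.2 z.norm_lt_one.le) (v.pos z).le)
      (fun z => mul_le_of_le_one_left (v.pos z).le ?_) v.tendsto_zero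
    linarith [norm_nonneg (z : ℂ)]

theorem Weight.distMul_apply (v : Weight) (z : 𝔻) : v.distMul z = (1 - ‖(z : ℂ)‖) * v z := rfl

theorem HInf.mul_norm_apply_le {v : Weight} (f : HInf v) (z : 𝔻) : v z * ‖f.toHolD z‖ ≤ ‖f‖ :=
  le_ciSup f.bdd z

theorem HInf.norm_le {v : Weight} (f : HInf v) {a : ℝ} (h : ∀ z, v z * ‖f.toHolD z‖ ≤ a) :
    ‖f‖ ≤ a := by
  have : Nonempty 𝔻 := ⟨0⟩
  exact ciSup_le h

/-- For a normal weight, `H_v^∞` embeds continuously into the Bloch-type space with weight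
`(1 - |z|) v(z)`. -/
theorem Weight.IsNormal.exists_toBloch {v : Weight} (hv : v.IsNormal) :
    ∃ J : HInf v →L[ℂ] Bloch v.distMul, ∀ f, (J f).toHolD = f.toHolD := by
  obtain ⟨C, hC, h⟩ := hv.exists_norm_dd_le
  have hb : ∀ f : HInf v, ∀ z, v.distMul z * ‖dd f.toHolD z‖ ≤ C * ‖f‖ := fun f z =>
    h f.toHolD ‖f‖ f.mul_norm_apply_le z
  let J : HInf v →ₗ[ℂ] Bloch v.distMul :=
    { toFun := fun f => ⟨f.toHolD, C * ‖f‖, by rintro _ ⟨z, rfl⟩; exact hb f z⟩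
      map_add' := fun f g => rfl
      map_smul' := fun c f => rfl }
  have hv0 := v.pos 0
  refine ⟨J.mkContinuous ((v 0)⁻¹ + C) fun f => ?_, fun f => rfl⟩
  have h0 : ‖f.toHolD 0‖ ≤ (v 0)⁻¹ * ‖f‖ := by
    rw [← div_eq_inv_mul, le_div_iff₀ hv0, mul_comm]
    exact f.mul_norm_apply_le 0
  rw [add_mul]
  exact (J f).norm_le h0 (hb f)

/-- For a normal weight, the Bloch-type space with weight `(1 - |z|) v(z)` embeds continuously
into `H_v^∞`. -/
theorem Weight.IsNormal.exists_toHInf {v : Weight} (hv : v.IsNormal) :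
    ∃ J : Bloch v.distMul →L[ℂ] HInf v, ∀ f, (J f).toHolD = f.toHolD := by
  obtain ⟨C, hC, h⟩ := hv.exists_norm_apply_le
  have hb : ∀ f : Bloch v.distMul, ∀ z, v z * ‖f.toHolD z‖ ≤ C * ‖f‖ := fun f z => by
    rw [Bloch.norm_def]
    exact h f.toHolD _ (fun w => le_ciSup f.bdd w) z
  let J : Bloch v.distMul →ₗ[ℂ] HInf v :=
    { toFun := fun f => ⟨f.toHolD, C * ‖f‖, by rintro _ ⟨z, rfl⟩; exact hb f z⟩
      map_add' := fun f g => rfl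
      map_smul' := fun c f => rfl }
  exact ⟨J.mkContinuous C fun f => (J f).norm_le (hb f), fun f => rfl⟩

end VolterraEss

end

/-! ### The main theorem -/

open VolterraEss in
theorem theorem3p7 {X : Type*} [NormedAddCommGroup X] [NormedSpace ℂ X] [CompleteSpace X]
    (ι : X →ₗ[ℂ] HolD) (hι : Function.Injective ι) (hconst : ContainsConstants ι)
    (hI : CondI ι) (hII : CondII ι) (hIII : CondIII ι) (hIV : CondIV ι) (hV : CondV ι) :
    (∀ v : Weight, v.IsNormal → ∃ c : ℝ≥0, 0 < c ∧
      ∀ (g : HolD) (φ : 𝔻 → 𝔻), IsHol (fun z => (φ z : ℂ)) →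
      ∀ T : X →L[ℂ] HInf v, (∀ f z, (T f).toHolD z = volterra g φ (ι f) z) →
        essNorm T ≤ c * limsupAt φ (fun z =>
          ENNReal.ofReal ((1 - ‖(z : ℂ)‖) * v z * ‖dd (fun w => g (φ w)) z‖) *
            evalNorm ι (φ z)) ∧
        limsupAt φ (fun z =>
          ENNReal.ofReal ((1 - ‖(z : ℂ)‖) * v z * ‖dd (fun w => g (φ w)) z‖) *
            evalNorm ι (φ z)) ≤ c * essNorm T) ∧
    (∃ c : ℝ≥0, 0 < c ∧ ∀ (v : Weight) (g : HolD) (φ : 𝔻 → 𝔻),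
      IsHol (fun z => (φ z : ℂ)) →
      ∀ T : X →L[ℂ] Bloch v, (∀ f z, (T f).toHolD z = volterra g φ (ι f) z) →
        essNorm T ≤ c * limsupAt φ (fun z =>
          ENNReal.ofReal (v z * ‖dd (fun w => g (φ w)) z‖) * evalNorm ι (φ z)) ∧
        limsupAt φ (fun z =>
          ENNReal.ofReal (v z * ‖dd (fun w => g (φ w)) z‖) * evalNorm ι (φ z)) ≤
            c * essNorm T) := by
  obtain ⟨c, hc, H⟩ := exists_essNorm_bloch_equiv hι hconst hI hII hIII hIV
  refine ⟨fun v hv => ?_, c, hc, H⟩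
  obtain ⟨J, hJ⟩ := hv.exists_toBloch
  obtain ⟨J', hJ'⟩ := hv.exists_toHInf
  set b : ℝ≥0 := ‖J‖₊ + ‖J'‖₊ + 1
  have hb : 0 < b := by positivity
  have hJb : ‖J‖ ≤ b := by
    change ‖J‖ ≤ ‖J‖ + ‖J'‖ + 1
    linarith [norm_nonneg J']
  have hJb' : ‖J'‖ ≤ b := by
    change ‖J'‖ ≤ ‖J‖ + ‖J'‖ + 1
    linarith [norm_nonneg J]
  refine ⟨b * c, mul_pos hb hc, fun g φ hφ T hT => ?_⟩
  -- Both embeddings leave the underlying function unchanged, so passing to the Bloch-type space and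
  -- back changes the essential norm by at most constant factors.
  have hJT : J'.comp (J.comp T) = T := by
    ext f
    apply Subtype.ext
    exact (hJ' (J (T f))).trans (hJ (T f))
  have hT' : ∀ f z, ((J.comp T) f).toHolD z = volterra g φ (ι f) z := fun f z => by
    rw [← hT, ContinuousLinearMap.comp_apply, hJ]
  obtain ⟨h1, h2⟩ := H v.distMul g φ hφ (J.comp T) hT'
  simp only [Weight.distMul_apply] at h1 h2
  constructor
  · have h3 := essNorm_comp_le J' (J.comp T) hb hJb'
    rw [hJT] at h3
    rw [ENNReal.coe_mul, mul_assoc]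
    exact h3.trans (by gcongr)
  · have h3 := essNorm_comp_le J T hb hJb
    rw [ENNReal.coe_mul, mul_comm (b : ℝ≥0∞), mul_assoc]
    exact h2.trans (by gcongr)
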